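/- Let $\ell \ge 2$ and let $m_2, n_2, m_3, n_3, \dots, m_\ell, n_\ell \ge 1$ be integers. **Monoid.** In the free monoid on $a_1,\dots,a_\ell$ define words inductively by $w_1 = a_1$ and $w_i = w_{i-1}^{m_i} \cdots w_2^{m_3} w_1^{m_2} a_i$ for $2 \le i \le \ell$, and let $$M = \langle a_1,\dots,a_\ell \mid a_{i-1} = a_i w_i^{n_i}\ (2 \le i \le \ell)\rangle^+ .$$ Then $M$ is of $O$-type, that is, $M$ is left- and right-cancellative, $1$ is its only invertible element, and for all $g,h\in M$ one of $g, h$ is a left-divisor of the other and one of $g,h$ is a right-divisor of the other. Moreover $a_1^N$ is central in $M$ for every integer $N \ge 0$ such that $(m_2+1)\cdots(m_i+1)$ divides $N(n_2+1)\cdots(n_{i-1}+1)$ for each $i = 2,\dots,\ell$; in particular $a_1^{(m_2+1)\cdots(m_\ell+1)}$ is central in $M$. **Group.** Let $$G = \langle x_1,\dots,x_\ell \mid x_{i-1}^{m_i+1} = x_i^{n_i+1}\ (2\le i\le \ell)\rangle .$$ Then $G$ is left-orderable, and the subsemigroup of $G$ generated by the elements $x_1^{-m_2}x_2^{-m_3}\cdots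 x_{i-1}^{-m_i}x_i$, $1 \le i \le \ell$ (that is, by $x_1$, $x_1^{-m_2}x_2$, $\dots$, $x_1^{-m_2}\cdots x_{\ell-1}^{-m_\ell}x_\ell$), is the positive cone $\{g \in G \mid g > 1\}$ of a left-invariant linear ordering of $G$ which is an isolated point of the space $\mathrm{LO}(G)$ of all left-invariant linear orderings of $G$, topologized as a subspace of $\{0,1\}^{G\times G}$ with the product topology. -/

import Mathlib

/-- A monoid is *of O-type* if it is cancellative, `1` is its only invertible element, and any two
elements are comparable both for left-divisibility (`g ∣ h` means `h = g * c` for some `c`) and for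
right-divisibility. -/
structure IsOType (M : Type*) [Monoid M] : Prop where
  left_cancel : ∀ h g g' : M, h * g = h * g' → g = g'
  right_cancel : ∀ h g g' : M, g * h = g' * h → g = g'
  eq_one_of_isUnit : ∀ g : M, IsUnit g → g = 1
  left_total : ∀ g h : M, (∃ c, g * c = h) ∨ (∃ c, h * c = g)
  right_total : ∀ g h : M, (∃ c, c * g = h) ∨ (∃ c, c * h = g)

/-- A left-invariant (strict, linear) ordering on the group `G`, that is, a point of `LO(G)`. -/
@[ext]
structure LeftOrdering (G : Type*) [Group G] where
  lt : G → G → Prop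
  irrefl : ∀ g, ¬ lt g g
  trans : ∀ f g h, lt f g → lt g h → lt f h
  total : ∀ g h, lt g h ∨ g = h ∨ lt h g
  mul_left : ∀ h g g', lt g g' → lt (h * g) (h * g')

namespace LeftOrdering

/-- The positive cone `{g | 1 < g}` of a left-invariant ordering. -/
def positiveCone {G : Type*} [Group G] (r : LeftOrdering G) : Set G := {g | r.lt 1 g}

open Classical in
/-- The topology of `LO(G)`: an ordering is viewed as a subset of `G × G`, and subsets of `G × G`
carry the product topology of `{0, 1} ^ (G × G)` (with `{0, 1} = Bool` discrete). -/
noncomputable instance {G : Type*} [Group G] : TopologicalSpace (LeftOrdering G) :=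
  TopologicalSpace.induced (fun r (p : G × G) => decide (r.lt p.1 p.2)) (inferInstance :
    TopologicalSpace (G × G → Bool))

/-- `r` is an isolated point of the space `LO(G)`. -/
def IsIsolated {G : Type*} [Group G] (r : LeftOrdering G) : Prop :=
  IsOpen ({r} : Set (LeftOrdering G))

end LeftOrdering

/- In what follows `ℓ = k + 1`. The generators with indices `1, …, ℓ` are indexed by
`0, …, k : Fin (k + 1)`, and the exponents `m_2, n_2, …, m_ℓ, n_ℓ` by `Fin k`:  `m j` and `n j`
(`j = 0, …, k - 1`) are the exponents relating the consecutive generators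
`j.castSucc` and `j.succ`. -/

namespace TriangularMonoid

open FreeMonoid in
/-- The word `w_{i-1}^{m_i} ⋯ w_2^{m_3} w_1^{m_2}` that precedes the last letter of `w_i`.
It is empty for the first index, and the next one is obtained by putting
`(w_{i-1})^{m_i}` in front, where `w_{i-1}` is the previous prefix followed by the letter
`a_{i-1}`. -/
def wordPrefix {k : ℕ} (m : Fin k → ℕ) (i : Fin (k + 1)) : FreeMonoid (Fin (k + 1)) :=
  Fin.induction (motive := fun _ => FreeMonoid (Fin (k + 1))) 1
    (fun j P => (P * of j.castSucc) ^ m j * P) i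

/-- The words `w_1 = a_1` and `w_i = w_{i-1}^{m_i} ⋯ w_2^{m_3} w_1^{m_2} a_i`. -/
def word {k : ℕ} (m : Fin k → ℕ) (i : Fin (k + 1)) : FreeMonoid (Fin (k + 1)) :=
  wordPrefix m i * FreeMonoid.of i

/-- The relations `a_{i-1} = a_i w_i^{n_i}`. -/
def rels {k : ℕ} (m n : Fin k → ℕ) (u v : FreeMonoid (Fin (k + 1))) : Prop :=
  ∃ j : Fin k, u = FreeMonoid.of j.castSucc ∧ v = FreeMonoid.of j.succ * word m j.succ ^ n j

end TriangularMonoid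

/-- The monoid `⟨a_1, …, a_ℓ | a_{i-1} = a_i w_i^{n_i} (2 ≤ i ≤ ℓ)⟩⁺`. -/
abbrev TriangularMonoid {k : ℕ} (m n : Fin k → ℕ) : Type :=
  PresentedMonoid (TriangularMonoid.rels m n)

/-- The group `⟨x_1, …, x_ℓ | x_{i-1}^{m_i + 1} = x_i^{n_i + 1} (2 ≤ i ≤ ℓ)⟩`. -/
abbrev TorusAmalgam {k : ℕ} (m n : Fin k → ℕ) : Type :=
  PresentedGroup (Set.range fun j : Fin k =>
    FreeGroup.of j.castSucc ^ (m j + 1) * (FreeGroup.of j.succ ^ (n j + 1))⁻¹)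

namespace TorusAmalgam

/-- The generators `x_1, …, x_ℓ`. -/
def x {k : ℕ} (m n : Fin k → ℕ) (i : Fin (k + 1)) : TorusAmalgam m n := PresentedGroup.of i

/-- The elements `x_1^{-m_2} x_2^{-m_3} ⋯ x_{i-1}^{-m_i} x_i`, equal to `x_1` for the first index.
(`Fin.partialProd f i` is the product of the first `i` entries of `f`, in increasing order.) -/
def coneGen {k : ℕ} (m n : Fin k → ℕ) (i : Fin (k + 1)) : TorusAmalgam m n :=
  Fin.partialProd (fun j : Fin k => (x m n j.castSucc ^ m j)⁻¹) i * x m n i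

end TorusAmalgam

/-! ### Right-triangular presentations -/

/-! Each relation rewrites a letter as a word beginning with the next letter, so `a_i = a_t D` for
some word `D` whenever `i ≤ t`. If a derivation leads from a word beginning with `a_i` to one
beginning with `a_t`, where `i < t`, then replacing `a_i` by `a_t D` and cancelling `a_t` leaves a
strictly shorter derivation (`deriv_cancel`). This gives left cancellation, and it makes the
letter-by-letter comparison of two words with a common right multiple terminate
(`comparable_of_deriv`).

Common multiples come from a central element that is a right multiple of every letter
(`total_of_central`). The identity `w_{i-1}^{m_i+1} = w_i^{n_i+1}` (`w_pow`) makes suitable powers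
of `a_1 = w_1` powers of every `w_i`, hence central (`pow_central`). The relations read backwards
are again triangular, so the same theory in the opposite monoid gives the right-handed half of
`isOType`.

For the group, `a_i ↦ coneGen i` sends `w_i` to `x_i`. By Ore's theorem the monoid embeds in some
group, and that embedding factors through `TorusAmalgam`, so `ofMonoid` is injective. Comparability
then makes the nontrivial elements of the monoid a positive cone; it is finitely generated as a
semigroup, which forces isolation. -/

namespace Triangular

variable {k : ℕ}

/-- One application of a relation `a_j = a_{j+1} C_j` inside a word, in either direction. -/
inductive Step (C : Fin k → List (Fin (k + 1))) : List (Fin (k + 1)) → List (Fin (k + 1)) → Prop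
  | up (j : Fin k) (T : List (Fin (k + 1))) : Step C (j.castSucc :: T) (j.succ :: (C j ++ T))
  | down (j : Fin k) (T : List (Fin (k + 1))) : Step C (j.succ :: (C j ++ T)) (j.castSucc :: T)
  | cons (a : Fin (k + 1)) {U V : List (Fin (k + 1))} : Step C U V → Step C (a :: U) (a :: V)

/-- `Deriv C r U V`: the word `U` can be transformed into `V` in at most `r` steps. -/
inductive Deriv (C : Fin k → List (Fin (k + 1))) :
    ℕ → List (Fin (k + 1)) → List (Fin (k + 1)) → Prop
  | refl (r : ℕ) (U : List (Fin (k + 1))) : Deriv C r U U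
  | head {r : ℕ} {U V W : List (Fin (k + 1))} : Step C U V → Deriv C r V W → Deriv C (r + 1) U W

/-- `Complement C i t D`: the letter `a_i` equals `a_t D` by iterated use of the relations. -/
inductive Complement (C : Fin k → List (Fin (k + 1))) :
    Fin (k + 1) → Fin (k + 1) → List (Fin (k + 1)) → Prop
  | refl (i : Fin (k + 1)) : Complement C i i []
  | cons {i t : Fin (k + 1)} {D : List (Fin (k + 1))} (j : Fin k) (hi : i = j.castSucc) :
      Complement C j.succ t D → Complement C i t (D ++ C j)

variable {C : Fin k → List (Fin (k + 1))} {r s : ℕ} {i t : Fin (k + 1)}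
  {D U V W : List (Fin (k + 1))}

lemma Step.symm (h : Step C U V) : Step C V U := by
  induction h with
  | up j T => exact .down j T
  | down j T => exact .up j T
  | cons a _ ih => exact .cons a ih

lemma Step.append_left (T : List (Fin (k + 1))) (h : Step C U V) : Step C (T ++ U) (T ++ V) := by
  induction T with
  | nil => exact h
  | cons a T ih => exact .cons a ih

lemma Step.append_right (T : List (Fin (k + 1))) (h : Step C U V) : Step C (U ++ T) (V ++ T) := by
  induction h with
  | up j S => simpa using Step.up (C := C) j (S ++ T)
  | down j S => simpa using Step.down (C := C) j (S ++ T)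
  | cons a _ ih => exact .cons a ih

lemma Step.ne_nil (h : Step C U V) : U ≠ [] := by
  cases h <;> simp

namespace Deriv

lemma mono (h : Deriv C r U V) (hrs : r ≤ s) : Deriv C s U V := by
  induction h generalizing s with
  | refl r U => exact .refl s U
  | head h _ ih =>
    obtain ⟨s, rfl⟩ : ∃ s', s = s' + 1 := ⟨s - 1, by omega⟩
    exact .head h (ih (by omega))

lemma trans (h : Deriv C r U V) (h' : Deriv C s V W) : Deriv C (r + s) U W := by
  induction h with
  | refl r U => exact h'.mono (by omega)
  | head h _ ih => exact (Deriv.head h (ih h')).mono (by omega)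

lemma single (h : Step C U V) : Deriv C 1 U V := .head h (.refl 0 V)

lemma symm (h : Deriv C r U V) : Deriv C r V U := by
  induction h with
  | refl r U => exact .refl r U
  | head h _ ih => exact ih.trans (single h.symm)

lemma append_left (T : List (Fin (k + 1))) (h : Deriv C r U V) :
    Deriv C r (T ++ U) (T ++ V) := by
  induction h with
  | refl r U => exact .refl r _
  | head h _ ih => exact .head (h.append_left T) ih

lemma append_right (T : List (Fin (k + 1))) (h : Deriv C r U V) :
    Deriv C r (U ++ T) (V ++ T) := by
  induction h with
  | refl r U => exact .refl r _
  | head h _ ih => exact .head (h.append_right T) ih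

lemma eq_nil (h : Deriv C r [] V) : V = [] := by
  cases h with
  | refl => rfl
  | head h _ => exact absurd rfl h.ne_nil

end Deriv

namespace Complement

lemma eq_or_lt (h : Complement C i t D) : (i = t ∧ D = []) ∨ i < t := by
  induction h with
  | refl i => exact .inl ⟨rfl, rfl⟩
  | cons j hi _ ih =>
    subst hi
    rcases ih with ⟨rfl, -⟩ | h
    · exact .inr j.castSucc_lt_succ
    · exact .inr (j.castSucc_lt_succ.trans h)

lemma exists_of_lt_succ {j : Fin k} (h : Complement C j.castSucc t D) (hne : j.castSucc ≠ t) :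
    ∃ D', Complement C j.succ t D' ∧ D = D' ++ C j := by
  generalize hi : j.castSucc = i at h
  cases h with
  | refl => exact absurd hi hne
  | cons j' hi' h =>
    obtain rfl : j = j' := Fin.castSucc_injective k (hi.trans hi')
    exact ⟨_, h, rfl⟩

lemma exists_of_le (C : Fin k → List (Fin (k + 1))) (h : i ≤ t) : ∃ D, Complement C i t D := by
  induction i using Fin.reverseInduction with
  | last => exact ⟨[], by rw [Fin.last_le_iff.1 h]; exact .refl _⟩
  | cast j ih =>
    rcases h.eq_or_lt with rfl | h
    · exact ⟨[], .refl _⟩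
    · obtain ⟨D, hD⟩ := ih (Fin.castSucc_lt_iff_succ_le.1 h)
      exact ⟨_, .cons j rfl hD⟩

lemma deriv (h : Complement C i t D) : ∃ r, Deriv C r [i] (t :: D) := by
  induction h with
  | refl i => exact ⟨0, .refl 0 _⟩
  | cons j hi _ ih =>
    subst hi
    obtain ⟨r, hr⟩ := ih
    exact ⟨r + 1, .head (.up j []) (by simpa using hr.append_right (C j))⟩

end Complement

/-- Left cancellation, with control on the length of derivations. -/
theorem deriv_cancel (r : ℕ) :
    (∀ i U V, Deriv C r (i :: U) (i :: V) → Deriv C r U V) ∧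
    (∀ i t D U V, Deriv C r (i :: U) (t :: V) → Complement C i t D → i ≠ t →
      ∃ r', r = r' + 1 ∧ Deriv C r' (D ++ U) V) := by
  induction r using Nat.strong_induction_on with
  | _ r ih =>
  -- Cancelling a whole word costs no steps, so it is available at every length below `r`.
  have cancel_append : ∀ s < r, ∀ S U V, Deriv C s (S ++ U) (S ++ V) → Deriv C s U V := by
    intro s hs S U V h
    induction S with
    | nil => exact h
    | cons a S ihS => exact ihS ((ih s hs).1 _ _ _ h)
  refine ⟨fun i U V h => ?_, fun i t D U V h hD hne => ?_⟩
  · generalize hX : i :: U = X at h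
    generalize hY : i :: V = Y at h
    cases h with
    | refl => obtain rfl : U = V := by simpa using hX.trans hY.symm
              exact .refl _ _
    | @head s _ Z _ hstep h =>
      subst hY
      have IH := ih s s.lt_succ_self
      cases hstep with
      -- The remaining steps must turn `a_{j+1}` back into `a_j`. Reversed, they fall under the
      -- second assertion with complement `C j`, which is then cancelled.
      | up j T =>
        obtain ⟨rfl, rfl⟩ : i = j.castSucc ∧ U = T := by simpa using hX
        obtain ⟨s', rfl, h'⟩ := IH.2 _ _ _ _ _ h.symm (.cons j rfl (.refl _))
          j.castSucc_lt_succ.ne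
        exact ((cancel_append s' (by omega) _ _ _ (by simpa using h')).symm).mono (by omega)
      | down j T =>
        obtain ⟨rfl, rfl⟩ : i = j.succ ∧ U = C j ++ T := by simpa using hX
        obtain ⟨s', rfl, h'⟩ := IH.2 _ _ _ _ _ h (.cons j rfl (.refl _))
          j.castSucc_lt_succ.ne
        exact Deriv.mono (by simpa using h') (by omega)
      | cons a hstep =>
        obtain ⟨rfl, rfl⟩ := List.cons_eq_cons.1 hX
        exact .head hstep (IH.1 _ _ _ h)
  · generalize hX : i :: U = X at h
    generalize hY : t :: V = Y at h
    cases h with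
    | refl => exact absurd (by simpa using congrArg List.head? (hX.trans hY.symm)) hne
    | @head s _ Z _ hstep h =>
      subst hY
      have IH := ih s s.lt_succ_self
      refine ⟨s, rfl, ?_⟩
      cases hstep with
      | up j T =>
        obtain ⟨rfl, rfl⟩ : i = j.castSucc ∧ U = T := by simpa using hX
        obtain ⟨D', hD', rfl⟩ := hD.exists_of_lt_succ hne
        rcases hD'.eq_or_lt with ⟨rfl, rfl⟩ | hlt
        · simpa using IH.1 _ _ _ h
        · obtain ⟨s', rfl, h'⟩ := IH.2 _ _ _ _ _ h hD' hlt.ne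
          exact Deriv.mono (by simpa using h') (by omega)
      -- The step moves the first letter away from `t`; the complement grows by exactly the `C j`
      -- that the step removed from `U`.
      | down j T =>
        obtain ⟨rfl, rfl⟩ : i = j.succ ∧ U = C j ++ T := by simpa using hX
        have hD' : Complement C j.castSucc t (D ++ C j) := .cons j rfl hD
        have hlt : j.castSucc < t := by
          rcases hD.eq_or_lt with ⟨rfl, -⟩ | hlt
          · exact absurd rfl hne
          · exact j.castSucc_lt_succ.trans hlt
        obtain ⟨s', rfl, h'⟩ := IH.2 _ _ _ _ _ h hD' hlt.ne
        exact Deriv.mono (by simpa using h') (by omega)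
      | cons a hstep =>
        obtain ⟨rfl, rfl⟩ := List.cons_eq_cons.1 hX
        obtain ⟨s', rfl, h'⟩ := IH.2 _ _ _ _ _ h hD hne
        exact .head (hstep.append_left D) h'

/-- The congruence generated by the relations `a_j = a_{j+1} C_j`, on words. -/
def Equivalent (C : Fin k → List (Fin (k + 1))) (U V : List (Fin (k + 1))) : Prop :=
  ∃ r, Deriv C r U V

namespace Equivalent

lemma refl (U : List (Fin (k + 1))) : Equivalent C U U := ⟨0, .refl 0 U⟩

lemma symm (h : Equivalent C U V) : Equivalent C V U := h.imp fun _ h => h.symm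

lemma trans (h : Equivalent C U V) (h' : Equivalent C V W) : Equivalent C U W :=
  let ⟨_, h⟩ := h
  let ⟨_, h'⟩ := h'
  ⟨_, h.trans h'⟩

lemma append_left (T : List (Fin (k + 1))) (h : Equivalent C U V) :
    Equivalent C (T ++ U) (T ++ V) := h.imp fun _ h => h.append_left T

lemma append_right (T : List (Fin (k + 1))) (h : Equivalent C U V) :
    Equivalent C (U ++ T) (V ++ T) := h.imp fun _ h => h.append_right T

lemma cancel_left (S : List (Fin (k + 1))) (h : Equivalent C (S ++ U) (S ++ V)) :
    Equivalent C U V := by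
  induction S with
  | nil => exact h
  | cons a S ih => exact ih (h.imp fun r h => (deriv_cancel r).1 _ _ _ h)

end Equivalent

/-- Two words with a common right multiple are comparable for left divisibility. -/
theorem comparable_of_deriv (r l : ℕ) : ∀ U U' V V' : List (Fin (k + 1)),
    U.length + V.length = l → Deriv C r (U ++ U') (V ++ V') →
      (∃ W, Equivalent C (U ++ W) V) ∨ (∃ W, Equivalent C (V ++ W) U) := by
  induction r using Nat.strong_induction_on generalizing l with
  | _ r ihr =>
  induction l using Nat.strong_induction_on with
  | _ l ihl =>
  intro U U' V V' hl h
  -- With distinct first letters the words may grow, but the derivation gets shorter; with equal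
  -- ones the derivation is no longer and the words shrink. Hence the lexicographic induction on
  -- `(r, l)`.
  have key : ∀ i t U U' V V', i < t → Deriv C r (i :: U ++ U') (t :: V ++ V') →
      (∃ W, Equivalent C (i :: U ++ W) (t :: V)) ∨ (∃ W, Equivalent C (t :: V ++ W) (i :: U)) := by
    intro i t U U' V V' hit h
    obtain ⟨D, hD⟩ := Complement.exists_of_le C hit.le
    obtain ⟨s, rfl, h'⟩ := (deriv_cancel r).2 _ _ _ _ _ h hD hit.ne
    have hi : Equivalent C [i] (t :: D) := hD.deriv
    rcases ihr s s.lt_succ_self _ (D ++ U) U' V V' rfl (by simpa using h') with ⟨W, hW⟩ | ⟨W, hW⟩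
    · refine .inl ⟨W, (hi.append_right (U ++ W)).trans ?_⟩
      simpa using hW.append_left [t]
    · refine .inr ⟨W, .trans ?_ (hi.append_right U).symm⟩
      simpa using hW.append_left [t]
  match U, V with
  | [], V => exact .inl ⟨V, .refl _⟩
  | U, [] => exact .inr ⟨U, .refl _⟩
  | i :: U, t :: V =>
    rcases lt_trichotomy i t with hit | rfl | hit
    · exact key i t U U' V V' hit h
    · have hl' : U.length + V.length < l := by simp at hl; omega
      rcases ihl _ hl' U U' V V' rfl ((deriv_cancel r).1 _ _ _ h) with ⟨W, hW⟩ | ⟨W, hW⟩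
      · exact .inl ⟨W, hW.append_left [i]⟩
      · exact .inr ⟨W, hW.append_left [i]⟩
    · exact (key t i V V' U U' hit h.symm).symm

/-- The monoid `M` is presented by the relations `a_j = a_{j+1} C_j`, through `π`. -/
structure Presents {M : Type*} [Monoid M] (C : Fin k → List (Fin (k + 1)))
    (π : FreeMonoid (Fin (k + 1)) →* M) : Prop where
  surjective : Function.Surjective π
  eq_iff : ∀ u v, π u = π v ↔ Equivalent C u.toList v.toList

namespace Presents

variable {M : Type*} [Monoid M] {π : FreeMonoid (Fin (k + 1)) →* M}

lemma left_cancel (hπ : Presents C π) (h g g' : M) (e : h * g = h * g') : g = g' := by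
  obtain ⟨u, rfl⟩ := hπ.surjective h
  obtain ⟨v, rfl⟩ := hπ.surjective g
  obtain ⟨w, rfl⟩ := hπ.surjective g'
  rw [← map_mul, ← map_mul, hπ.eq_iff] at e
  exact (hπ.eq_iff _ _).2 (Equivalent.cancel_left u.toList e)

/-- Both sides of each relation are nonempty, so no step applies to the empty word. -/
lemma map_eq_one_iff (hπ : Presents C π) (u : FreeMonoid (Fin (k + 1))) : π u = 1 ↔ u = 1 := by
  refine ⟨fun h => ?_, fun h => by rw [h, map_one]⟩
  rw [← map_one π, eq_comm, hπ.eq_iff] at h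
  obtain ⟨r, h⟩ := h
  exact h.eq_nil

lemma eq_one_of_mul_eq_one (hπ : Presents C π) (g h : M) (e : g * h = 1) : g = 1 := by
  obtain ⟨u, rfl⟩ := hπ.surjective g
  obtain ⟨v, rfl⟩ := hπ.surjective h
  rw [← map_mul, hπ.map_eq_one_iff] at e
  have : u = 1 := (List.append_eq_nil_iff.1 e).1
  rw [this, map_one]

lemma comparable (hπ : Presents C π) (g h g' h' : M) (e : g * g' = h * h') :
    (∃ c, g * c = h) ∨ (∃ c, h * c = g) := by
  obtain ⟨u, rfl⟩ := hπ.surjective g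
  obtain ⟨v, rfl⟩ := hπ.surjective h
  obtain ⟨u', rfl⟩ := hπ.surjective g'
  obtain ⟨v', rfl⟩ := hπ.surjective h'
  rw [← map_mul, ← map_mul, hπ.eq_iff] at e
  obtain ⟨r, e⟩ := e
  refine (comparable_of_deriv r _ u.toList u'.toList v.toList v'.toList rfl e).imp ?_ ?_ <;>
  · rintro ⟨W, hW⟩
    exact ⟨π (.ofList W), by rw [← map_mul, hπ.eq_iff]; exact hW⟩

lemma of_dvd_of (hπ : Presents C π) {i t : Fin (k + 1)} (hit : i ≤ t) :
    ∃ c, π (.of t) * c = π (.of i) := by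
  obtain ⟨D, hD⟩ := Complement.exists_of_le C hit
  exact ⟨π (.ofList D), by rw [← map_mul, hπ.eq_iff]; exact Equivalent.symm hD.deriv⟩

/-- In the presence of a central element divisible by all letters, any two elements are comparable
for left divisibility. -/
lemma total_of_central (hπ : Presents C π) (z : M) (hz : ∀ g, z * g = g * z)
    (hdvd : ∀ i, ∃ c, π (.of i) * c = z) (g h : M) :
    (∃ c, g * c = h) ∨ (∃ c, h * c = g) := by
  have hzp : ∀ (N : ℕ) g, z ^ N * g = g * z ^ N := fun N g =>
    (Commute.pow_left (hz g) N).eq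
  have dvd_pow : ∀ g : M, ∃ N c, g * c = z ^ N := by
    intro g
    obtain ⟨u, rfl⟩ := hπ.surjective g
    induction u using FreeMonoid.inductionOn' with
    | one => exact ⟨0, 1, by simp⟩
    | of_mul i u ih =>
      obtain ⟨N, c, hc⟩ := ih
      obtain ⟨d, hd⟩ := hdvd i
      refine ⟨N + 1, c * d, ?_⟩
      rw [map_mul, mul_assoc, ← mul_assoc _ c d, hc, hzp, ← mul_assoc, hd, pow_succ']
  obtain ⟨N, c, hc⟩ := dvd_pow g
  obtain ⟨N', c', hc'⟩ := dvd_pow h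
  refine hπ.comparable g h (c * z ^ N') (c' * z ^ N) ?_
  rw [← mul_assoc, ← mul_assoc, hc, hc', hzp]

end Presents

end Triangular

/-! ### The monoid is of O-type -/

namespace Triangular

variable {k : ℕ}

/-- `Equivalent` as a congruence on the free monoid. -/
def equivalentCon (C : Fin k → List (Fin (k + 1))) : Con (FreeMonoid (Fin (k + 1))) where
  r u v := Equivalent C u.toList v.toList
  iseqv := ⟨fun _ => .refl _, .symm, .trans⟩
  mul' {_ x y _} h h' := (h.append_right y.toList).trans (h'.append_left x.toList)

/-- `Equivalent` on reversed words, as a congruence on the free monoid. -/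
def reverseCon (C : Fin k → List (Fin (k + 1))) : Con (FreeMonoid (Fin (k + 1))) where
  r u v := Equivalent C u.reverse.toList v.reverse.toList
  iseqv := ⟨fun _ => .refl _, .symm, .trans⟩
  mul' {w x y z} h h' := by
    rw [FreeMonoid.reverse_mul, FreeMonoid.reverse_mul]
    exact (h'.append_right w.reverse.toList).trans (h.append_left z.reverse.toList)

lemma map_eq_of_equivalent {M : Type*} [Monoid M] {C : Fin k → List (Fin (k + 1))}
    (π : FreeMonoid (Fin (k + 1)) →* M)
    (hπ : ∀ j, π (.of j.castSucc) = π (.of j.succ) * π (.ofList (C j)))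
    {U V : List (Fin (k + 1))} (h : Equivalent C U V) :
    π (.ofList U) = π (.ofList V) := by
  obtain ⟨r, h⟩ := h
  have map_cons : ∀ a T, π (.ofList (a :: T)) = π (.of a) * π (.ofList T) := fun a T => by
    rw [← map_mul]; rfl
  induction h with
  | refl => rfl
  | head h _ ih =>
    rw [← ih]
    clear ih
    rename_i h'
    clear h'
    induction h with
    | up j T => rw [map_cons, map_cons, FreeMonoid.ofList_append, map_mul, hπ, mul_assoc]
    | down j T => rw [map_cons, map_cons, FreeMonoid.ofList_append, map_mul, hπ, mul_assoc]
    | cons a _ ih => rw [map_cons, map_cons, ih]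

end Triangular

/-! ### The mirrored presentation and the central powers of `a_1` -/

namespace TriangularMonoid

open FreeMonoid Triangular

variable {k : ℕ} (m n : Fin k → ℕ)

lemma wordPrefix_zero : wordPrefix m 0 = 1 := rfl

lemma wordPrefix_succ (j : Fin k) :
    wordPrefix m j.succ = word m j.castSucc ^ m j * wordPrefix m j.castSucc := by
  simp [wordPrefix, word]

/-- The word `w_{j+1}^{n_{j+1}}` of the relation `a_j = a_{j+1} w_{j+1}^{n_{j+1}}`. -/
def rightWord (j : Fin k) : List (Fin (k + 1)) := (word m j.succ ^ n j).toList

/-- The reverse of the word that precedes the last letter of `a_{j+1} w_{j+1}^{n_{j+1}}`. -/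
def leftWord (j : Fin k) : List (Fin (k + 1)) :=
  (of j.succ * word m j.succ ^ (n j - 1) * wordPrefix m j.succ).reverse.toList

lemma presents_mk : Presents (rightWord m n) (PresentedMonoid.mk (rels m n)) where
  surjective := PresentedMonoid.surjective_mk
  eq_iff u v := by
    refine ⟨fun h => ?_, fun h => ?_⟩
    · have hle : conGen (rels m n) ≤ equivalentCon (rightWord m n) := by
        refine Con.conGen_le.2 ?_
        rintro _ _ ⟨j, rfl, rfl⟩
        exact ⟨1, .single (by simpa [rightWord] using Step.up (C := rightWord m n) j [])⟩
      exact hle (PresentedMonoid.mk_eq_mk_iff.1 h)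
    · refine map_eq_of_equivalent _ (fun j => ?_) h
      rw [← map_mul]
      exact PresentedMonoid.mk_eq_mk_of_rel ⟨j, rfl, rfl⟩

/-- The anti-homomorphism from words to the monoid. -/
def mkOp : FreeMonoid (Fin (k + 1)) →* (TriangularMonoid m n)ᵐᵒᵖ where
  toFun u := .op (PresentedMonoid.mk (rels m n) u.reverse)
  map_one' := rfl
  map_mul' u v := by rw [reverse_mul, map_mul, MulOpposite.op_mul]

variable {n}

lemma mul_word_pow_eq (hn : ∀ j, 1 ≤ n j) (j : Fin k) :
    of j.succ * word m j.succ ^ n j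
      = of j.succ * word m j.succ ^ (n j - 1) * wordPrefix m j.succ * of j.succ := by
  obtain ⟨p, hp⟩ : ∃ p, n j = p + 1 := ⟨n j - 1, by have := hn j; omega⟩
  simp only [hp, pow_succ, Nat.add_sub_cancel, mul_assoc]
  rfl

/-- Since `n j ≥ 1`, the right-hand side of each relation also ends with the letter `a_{j+1}`, so
the reversed relations have the same triangular shape. -/
lemma presents_mkOp (hn : ∀ j, 1 ≤ n j) : Presents (leftWord m n) (mkOp m n) where
  surjective g := by
    obtain ⟨u, hu⟩ := PresentedMonoid.surjective_mk g.unop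
    exact ⟨u.reverse, MulOpposite.unop_injective (by
      rw [← hu]
      exact congrArg (PresentedMonoid.mk (rels m n)) u.reverse_reverse)⟩
  eq_iff u v := by
    refine ⟨fun h => ?_, fun h => ?_⟩
    · have hle : conGen (rels m n) ≤ reverseCon (leftWord m n) := by
        refine Con.conGen_le.2 ?_
        rintro _ _ ⟨j, rfl, rfl⟩
        rw [mul_word_pow_eq m hn]
        change Equivalent _ (reverse _).toList (reverse (_ * of _)).toList
        rw [reverse_mul]
        exact ⟨1, .single (by simpa [leftWord] using Step.up (C := leftWord m n) j [])⟩
      have := hle (PresentedMonoid.mk_eq_mk_iff.1 (MulOpposite.op_injective h))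
      change Equivalent _ u.reverse.reverse.toList v.reverse.reverse.toList at this
      rwa [reverse_reverse, reverse_reverse] at this
    · refine map_eq_of_equivalent _ (fun j => ?_) h
      rw [← map_mul]
      refine congrArg MulOpposite.op (PresentedMonoid.mk_eq_mk_of_rel ⟨j, rfl, ?_⟩)
      rw [reverse_mul, mul_word_pow_eq m hn, leftWord, ofList_toList, reverse_reverse, reverse_of]

variable (n)

/-- The image in the monoid of the word `w_i`. -/
def w (i : Fin (k + 1)) : TriangularMonoid m n := PresentedMonoid.mk (rels m n) (word m i)

lemma w_zero : w m n 0 = PresentedMonoid.of (rels m n) 0 := rfl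

lemma of_castSucc (j : Fin k) : PresentedMonoid.of (rels m n) j.castSucc
    = PresentedMonoid.of (rels m n) j.succ * w m n j.succ ^ n j := by
  rw [w, ← map_pow, PresentedMonoid.of, PresentedMonoid.of, ← map_mul]
  exact PresentedMonoid.mk_eq_mk_of_rel ⟨j, rfl, rfl⟩

lemma w_eq (i : Fin (k + 1)) :
    w m n i = PresentedMonoid.mk (rels m n) (wordPrefix m i) * PresentedMonoid.of (rels m n) i := by
  rw [w, word, map_mul]; rfl

lemma w_succ (j : Fin k) : w m n j.succ
    = w m n j.castSucc ^ m j * PresentedMonoid.mk (rels m n) (wordPrefix m j.castSucc)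
      * PresentedMonoid.of (rels m n) j.succ := by
  rw [w_eq, wordPrefix_succ, map_mul, map_pow, ← w]

lemma w_pow (j : Fin k) : w m n j.castSucc ^ (m j + 1) = w m n j.succ ^ (n j + 1) := by
  have h : w m n j.castSucc = PresentedMonoid.mk (rels m n) (wordPrefix m j.castSucc)
      * (PresentedMonoid.of (rels m n) j.succ * w m n j.succ ^ n j) := by
    rw [w_eq, of_castSucc]
  calc w m n j.castSucc ^ (m j + 1)
      = w m n j.castSucc ^ m j * (PresentedMonoid.mk (rels m n) (wordPrefix m j.castSucc)
        * (PresentedMonoid.of (rels m n) j.succ * w m n j.succ ^ n j)) := by rw [pow_succ, ← h]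
    _ = w m n j.succ ^ (n j + 1) := by
      rw [pow_succ' _ (n j), w_succ]
      simp only [mul_assoc]

lemma prod_Iic_eq (f : Fin k → ℕ) (j : Fin k) :
    ∏ i ∈ Finset.Iic j, f i = f j * ∏ i ∈ Finset.Iio j, f i := by
  rw [← Finset.Iio_insert j, Finset.prod_insert (by simp)]

/-- Explicit powers of `a_1` that are powers of all the `w_i`. -/
lemma exists_w_pow_eq (N : ℕ)
    (hN : ∀ i : Fin k, (∏ j ∈ Finset.Iic i, (m j + 1)) ∣ N * ∏ j ∈ Finset.Iio i, (n j + 1))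
    (i : Fin (k + 1)) :
    ∃ K, w m n 0 ^ N = w m n i ^ K ∧
      K * ∏ j ∈ Finset.univ.filter (fun j : Fin k => j.castSucc < i), (m j + 1)
        = N * ∏ j ∈ Finset.univ.filter (fun j : Fin k => j.castSucc < i), (n j + 1) := by
  induction i using Fin.induction with
  | zero => exact ⟨N, rfl, by simp⟩
  | succ j ih =>
    obtain ⟨K, hK, e⟩ := ih
    have h1 : (Finset.univ.filter fun i : Fin k => i.castSucc < j.castSucc) = Finset.Iio j := by
      ext i; simp
    have h2 : (Finset.univ.filter fun i : Fin k => i.castSucc < j.succ) = Finset.Iic j := by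
      ext i; simp [Fin.castSucc_lt_succ_iff]
    rw [h1] at e
    have hpos : 0 < ∏ i ∈ Finset.Iio j, (m i + 1) := Finset.prod_pos fun _ _ => Nat.succ_pos _
    -- By the invariant `e`, the hypothesis at `j` says that the product of the `m i + 1` over `i ≤
    -- j` divides `K` times the product over `i < j`.
    obtain ⟨c, rfl⟩ : m j + 1 ∣ K := by
      have := hN j
      rw [← e, prod_Iic_eq] at this
      exact Nat.dvd_of_mul_dvd_mul_right hpos this
    refine ⟨(n j + 1) * c, by rw [hK, pow_mul, w_pow, pow_mul], ?_⟩
    rw [h2, prod_Iic_eq, prod_Iic_eq]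
    linear_combination (n j + 1) * e

lemma pow_central (N : ℕ)
    (hN : ∀ i : Fin k, (∏ j ∈ Finset.Iic i, (m j + 1)) ∣ N * ∏ j ∈ Finset.Iio i, (n j + 1))
    (g : TriangularMonoid m n) :
    PresentedMonoid.of (rels m n) 0 ^ N * g = g * PresentedMonoid.of (rels m n) 0 ^ N := by
  rw [← w_zero]
  have hw : ∀ i, Commute (w m n 0 ^ N) (w m n i) := fun i => by
    obtain ⟨K, hK, -⟩ := exists_w_pow_eq m n N hN i
    rw [hK]
    exact Commute.pow_self _ _
  have hP : ∀ i, Commute (w m n 0 ^ N) (PresentedMonoid.mk (rels m n) (wordPrefix m i)) := by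
    intro i
    induction i using Fin.induction with
    | zero => rw [wordPrefix_zero, map_one]; exact Commute.one_right _
    | succ j ih =>
      rw [wordPrefix_succ, map_mul, map_pow]
      exact ((hw j.castSucc).pow_right _).mul_right ih
  -- The power commutes with `w_i` and with its prefix; left cancellation of the prefix leaves the
  -- last letter.
  have ha : ∀ i, Commute (w m n 0 ^ N) (PresentedMonoid.of (rels m n) i) := by
    intro i
    refine (presents_mk m n).left_cancel (PresentedMonoid.mk (rels m n) (wordPrefix m i)) _ _ ?_
    rw [← mul_assoc, ← (hP i).eq, mul_assoc, ← w_eq, (hw i).eq, w_eq, mul_assoc]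
  obtain ⟨u, rfl⟩ := PresentedMonoid.surjective_mk g
  induction u using FreeMonoid.inductionOn' with
  | one => exact Commute.one_right _
  | of_mul i u ih =>
    rw [map_mul]
    exact (ha i).mul_right ih

lemma prod_dvd (i : Fin k) : (∏ j ∈ Finset.Iic i, (m j + 1)) ∣
    (∏ j, (m j + 1)) * ∏ j ∈ Finset.Iio i, (n j + 1) :=
  (Finset.prod_dvd_prod_of_subset _ _ _ (Finset.subset_univ _)).mul_right _

variable {n}

theorem isOType (hn : ∀ j, 1 ≤ n j) : IsOType (TriangularMonoid m n) := by
  have hL := presents_mk m n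
  have hR := presents_mkOp m hn
  -- A positive exponent lets one factor `a_1` split off; every letter divides `a_1`, hence the
  -- central power.
  obtain ⟨p, hp⟩ : ∃ p, ∏ j, (m j + 1) = p + 1 :=
    ⟨_, (Nat.succ_pred_eq_of_pos (Finset.prod_pos fun _ _ => Nat.succ_pos _)).symm⟩
  have hz := pow_central m n _ (prod_dvd m n)
  rw [hp] at hz
  refine ⟨hL.left_cancel, fun h g g' e => ?_, fun g hg => ?_, ?_, fun g h => ?_⟩
  · exact MulOpposite.op_injective (hR.left_cancel (.op h) _ _ (congrArg MulOpposite.op e))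
  · obtain ⟨c, hc⟩ := hg.exists_right_inv
    exact hL.eq_one_of_mul_eq_one _ _ hc
  · refine hL.total_of_central _ hz fun i => ?_
    obtain ⟨c, hc⟩ := hL.of_dvd_of (Fin.zero_le i)
    exact ⟨c * PresentedMonoid.of (rels m n) 0 ^ p, by rw [← mul_assoc, hc, pow_succ']; rfl⟩
  · have := hR.total_of_central (.op (PresentedMonoid.of (rels m n) 0 ^ (p + 1)))
      (fun g => MulOpposite.unop_injective (hz g.unop).symm) (fun i => ?_) (.op g) (.op h)
    · refine this.imp ?_ ?_ <;>
      · rintro ⟨c, hc⟩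
        exact ⟨c.unop, MulOpposite.op_injective (by simpa using hc)⟩
    · obtain ⟨c, hc⟩ := hR.of_dvd_of (Fin.zero_le i)
      refine ⟨c * .op (PresentedMonoid.of (rels m n) 0 ^ p), ?_⟩
      rw [← mul_assoc, hc, pow_succ, MulOpposite.op_mul]
      rfl

end TriangularMonoid

/-! ### Left-orderings from monoids of O-type -/

namespace LeftOrdering

variable {G : Type*} [Group G]

lemma lt_iff (r : LeftOrdering G) (g h : G) : r.lt g h ↔ g⁻¹ * h ∈ r.positiveCone := by
  refine ⟨fun e => ?_, fun e => ?_⟩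
  · simpa [positiveCone] using r.mul_left g⁻¹ _ _ e
  · simpa using r.mul_left g _ _ e

lemma mul_mem_positiveCone (r : LeftOrdering G) {g h : G} (hg : g ∈ r.positiveCone)
    (hh : h ∈ r.positiveCone) : g * h ∈ r.positiveCone :=
  r.trans _ _ _ hg (by simpa using r.mul_left g _ _ hh)

/-- A strict linear order has no proper extension to another one. -/
lemma eq_of_lt_imp {r s : LeftOrdering G} (h : ∀ a b, r.lt a b → s.lt a b) : r = s := by
  ext a b
  refine ⟨h a b, fun hab => ?_⟩
  rcases r.total a b with h' | rfl | h'
  · exact h'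
  · exact absurd hab (s.irrefl _)
  · exact absurd (s.trans _ _ _ hab (h _ _ h')) (s.irrefl _)

lemma isOpen_setOf_lt (a b : G) : IsOpen {r : LeftOrdering G | r.lt a b} := by
  classical
  have hc : Continuous fun (r : LeftOrdering G) (p : G × G) =>
      @decide (r.lt p.1 p.2) (Classical.propDecidable _) := continuous_induced_dom
  have := ((continuous_apply (a, b)).comp hc).isOpen_preimage {true} (isOpen_discrete _)
  convert this using 1
  ext r
  simp

/-- A left-invariant ordering whose positive cone is a finitely generated semigroup is isolated. -/
theorem isIsolated_of_positiveCone_eq {ι : Type*} [Finite ι] (r : LeftOrdering G) (c : ι → G)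
    (hr : r.positiveCone = Subsemigroup.closure (Set.range c)) : r.IsIsolated := by
  have : ({r} : Set (LeftOrdering G)) = ⋂ i, {s | s.lt 1 (c i)} := by
    ext s
    simp only [Set.mem_singleton_iff, Set.mem_iInter, Set.mem_ofPred_eq]
    refine ⟨?_, fun h => ?_⟩
    · rintro rfl i
      have : c i ∈ s.positiveCone := hr ▸ Subsemigroup.subset_closure ⟨i, rfl⟩
      exact this
    -- Once the generators are positive for `s`, its cone contains that of `r`.
    · let P : Subsemigroup G := ⟨s.positiveCone, s.mul_mem_positiveCone⟩
      have hP : Subsemigroup.closure (Set.range c) ≤ P :=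
        Subsemigroup.closure_le.2 (by rintro _ ⟨i, rfl⟩; exact h i)
      refine (eq_of_lt_imp fun a b hab => ?_).symm
      rw [lt_iff, hr] at hab
      exact (s.lt_iff a b).2 (hP hab)
  rw [IsIsolated, this]
  exact isOpen_iInter_of_finite fun i => isOpen_setOf_lt _ _

end LeftOrdering

namespace IsOType

universe u

variable {M : Type u} [Monoid M]

lemma eq_one_of_mul_eq_one (hM : IsOType M) {g h : M} (e : g * h = 1) : g = 1 := by
  have e' : h * g = 1 := hM.left_cancel g _ _ (by rw [← mul_assoc, e, one_mul, mul_one])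
  exact hM.eq_one_of_isUnit g ⟨⟨g, h, e, e'⟩, rfl⟩

lemma exists_common_left_multiple (hM : IsOType M) (g h : M) : ∃ a b, b * g = a * h := by
  rcases hM.right_total g h with ⟨c, hc⟩ | ⟨c, hc⟩
  · exact ⟨1, c, by rw [hc, one_mul]⟩
  · exact ⟨c, 1, by rw [hc, one_mul]⟩

/-- A monoid of O-type embeds in a group. -/
theorem exists_embedding (hM : IsOType M) :
    ∃ (H : Type u) (_ : Group H) (f : M →* H), Function.Injective f := by
  choose num den hore using hM.exists_common_left_multiple
  let _ : OreLocalization.OreSet (⊤ : Submonoid M) :=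
    { ore_right_cancel := fun a b s h => ⟨1, by rw [hM.right_cancel _ _ _ h]⟩
      oreNum := fun r s => num r s
      oreDenom := fun r s => ⟨den r s, trivial⟩
      ore_eq := fun r s => hore r s }
  let f : M →* OreLocalization (⊤ : Submonoid M) M := OreLocalization.numeratorHom
  have hu : ∀ g, IsUnit (f g) := fun g =>
    OreLocalization.numerator_isUnit (⟨g, trivial⟩ : (⊤ : Submonoid M))
  refine ⟨(OreLocalization (⊤ : Submonoid M) M)ˣ, inferInstance,
    { toFun := fun g => (hu g).unit
      map_one' := Units.ext (map_one f)
      map_mul' := fun a b => Units.ext (map_mul f a b) }, fun g h e => ?_⟩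
  have e' : f g = f h := congrArg Units.val e
  obtain ⟨a, b, h1, h2⟩ := OreLocalization.oreDiv_eq_iff.1 e'
  have hab : (a : M) = b := by simpa using h2
  refine (hM.left_cancel b _ _ ?_).symm
  rw [← hab]
  rw [← hab] at h1
  exact h1

variable {G : Type*} [Group G] (f : M →* G)

/-- The images and their inverses are closed under products: right comparability simplifies `f a *
(f b)⁻¹`, left comparability `(f a)⁻¹ * f b`. -/
lemma exists_map_eq_or_inv (hM : IsOType M) (hf : Subgroup.closure (Set.range f) = ⊤) (g : G) :
    (∃ a, f a = g) ∨ ∃ a, f a = g⁻¹ := by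
  have mul_inv_mem : ∀ a b, (∃ c, f c = f a * (f b)⁻¹) ∨ ∃ c, f c = (f a * (f b)⁻¹)⁻¹ := by
    intro a b
    rcases hM.right_total a b with ⟨c, rfl⟩ | ⟨c, rfl⟩
    · exact .inr ⟨c, by simp⟩
    · exact .inl ⟨c, by simp⟩
  have inv_mul_mem : ∀ a b, (∃ c, f c = (f a)⁻¹ * f b) ∨ ∃ c, f c = ((f a)⁻¹ * f b)⁻¹ := by
    intro a b
    rcases hM.left_total a b with ⟨c, rfl⟩ | ⟨c, rfl⟩
    · exact .inl ⟨c, by simp⟩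
    · exact .inr ⟨c, by simp⟩
  have hg : g ∈ Subgroup.closure (Set.range f) := hf ▸ trivial
  induction hg using Subgroup.closure_induction with
  | mem x hx => exact .inl hx
  | one => exact .inl ⟨1, map_one f⟩
  | inv x _ ih => rwa [inv_inv, or_comm]
  | mul x y _ _ ihx ihy =>
    rcases ihx with ⟨a, ha⟩ | ⟨a, ha⟩ <;> rcases ihy with ⟨b, hb⟩ | ⟨b, hb⟩
    · exact .inl ⟨a * b, by rw [map_mul, ha, hb]⟩
    · simpa [ha, hb] using mul_inv_mem a b
    · simpa [ha, hb] using inv_mul_mem a b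
    · exact .inr ⟨b * a, by rw [map_mul, ha, hb, mul_inv_rev]⟩

/-- A group generated by a submonoid of O-type is left-ordered by it. -/
theorem exists_leftOrdering (hM : IsOType M) (hinj : Function.Injective f)
    (hf : Subgroup.closure (Set.range f) = ⊤) :
    ∃ r : LeftOrdering G, r.positiveCone = f '' {a | a ≠ 1} := by
  refine ⟨
    { lt := fun g h => ∃ a, a ≠ 1 ∧ f a = g⁻¹ * h
      irrefl := ?_
      trans := ?_
      total := ?_
      mul_left := ?_ }, ?_⟩
  · rintro g ⟨a, ha, e⟩
    exact ha (hinj (by rw [e, inv_mul_cancel, map_one]))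
  · rintro x y z ⟨a, ha, e⟩ ⟨b, -, e'⟩
    exact ⟨a * b, fun h => ha (hM.eq_one_of_mul_eq_one h), by rw [map_mul, e, e']; group⟩
  · intro g h
    by_cases hgh : g = h
    · exact .inr (.inl hgh)
    have hne : ∀ x y : G, x ≠ y → ∀ a, f a = x⁻¹ * y → a ≠ 1 := by
      rintro x y hxy a e rfl
      rw [map_one, eq_comm, inv_mul_eq_one] at e
      exact hxy e
    rcases hM.exists_map_eq_or_inv f hf (g⁻¹ * h) with ⟨a, ha⟩ | ⟨a, ha⟩
    · exact .inl ⟨a, hne _ _ hgh a ha, ha⟩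
    · have ha' : f a = h⁻¹ * g := by simpa using ha
      exact .inr (.inr ⟨a, hne _ _ (Ne.symm hgh) a ha', ha'⟩)
  · rintro h x y ⟨a, ha, e⟩
    exact ⟨a, ha, by rw [e]; group⟩
  · ext g
    simp [LeftOrdering.positiveCone]

end IsOType

/-! ### The group -/

namespace TorusAmalgam

open FreeMonoid TriangularMonoid

variable {k : ℕ} (m n : Fin k → ℕ)

lemma x_pow (j : Fin k) : x m n j.castSucc ^ (m j + 1) = x m n j.succ ^ (n j + 1) := by
  have h := PresentedGroup.one_of_mem (rels := Set.range fun j : Fin k =>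
    FreeGroup.of j.castSucc ^ (m j + 1) * (FreeGroup.of j.succ ^ (n j + 1))⁻¹) ⟨j, rfl⟩
  rw [map_mul, map_inv, map_pow, map_pow] at h
  exact mul_inv_eq_one.1 h

/-- Kept conditional because the induction in `lift_wordPrefix` needs it at the previous index. -/
lemma lift_word_of_lift_wordPrefix {i : Fin (k + 1)} (h : FreeMonoid.lift (coneGen m n)
      (wordPrefix m i) = (Fin.partialProd (fun j : Fin k => (x m n j.castSucc ^ m j)⁻¹) i)⁻¹) :
    FreeMonoid.lift (coneGen m n) (word m i) = x m n i := by
  rw [word, map_mul, h, FreeMonoid.lift_eval_of, coneGen, inv_mul_cancel_left]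

lemma lift_wordPrefix (i : Fin (k + 1)) : FreeMonoid.lift (coneGen m n) (wordPrefix m i)
    = (Fin.partialProd (fun j : Fin k => (x m n j.castSucc ^ m j)⁻¹) i)⁻¹ := by
  induction i using Fin.induction with
  | zero => simp [wordPrefix_zero]
  | succ j ih =>
    rw [wordPrefix_succ, map_mul, map_pow, lift_word_of_lift_wordPrefix m n ih, ih,
      Fin.partialProd_succ, mul_inv_rev, inv_inv]

lemma lift_word (i : Fin (k + 1)) : FreeMonoid.lift (coneGen m n) (word m i) = x m n i :=
  lift_word_of_lift_wordPrefix m n (lift_wordPrefix m n i)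

/-- The homomorphism from the monoid to the group that maps `a_i` to `coneGen i`. -/
def ofMonoid : TriangularMonoid m n →* TorusAmalgam m n :=
  PresentedMonoid.lift (coneGen m n) <| by
    rintro _ _ ⟨j, rfl, rfl⟩
    rw [map_mul, map_pow, lift_word, FreeMonoid.lift_eval_of, FreeMonoid.lift_eval_of, coneGen,
      coneGen, Fin.partialProd_succ, mul_assoc, mul_assoc, ← pow_succ', ← x_pow, pow_succ,
      inv_mul_cancel_left]

lemma ofMonoid_of (i : Fin (k + 1)) :
    ofMonoid m n (PresentedMonoid.of (rels m n) i) = coneGen m n i := rfl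

lemma ofMonoid_w (i : Fin (k + 1)) : ofMonoid m n (w m n i) = x m n i := lift_word m n i

lemma closure_range_ofMonoid : Subgroup.closure (Set.range (ofMonoid m n)) = ⊤ := by
  refine top_unique ?_
  rw [← PresentedGroup.closure_range_of]
  refine Subgroup.closure_mono ?_
  rintro _ ⟨i, rfl⟩
  exact ⟨w m n i, ofMonoid_w m n i⟩

variable {n}

/-- By `w_pow`, the images of the `w_i` in an ambient group `H` satisfy the relations of the `x_i`.
The resulting `F` composed with `ofMonoid` is the embedding into `H`, so no normal form in the
amalgam is required. -/
lemma ofMonoid_injective (hn : ∀ j, 1 ≤ n j) : Function.Injective (ofMonoid m n) := by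
  obtain ⟨H, _, f, hf⟩ := (isOType m hn).exists_embedding
  let F : TorusAmalgam m n →* H := PresentedGroup.toGroup (f := fun i => f (w m n i)) <| by
    rintro _ ⟨j, rfl⟩
    rw [map_mul, map_inv, map_pow, map_pow, FreeGroup.lift_apply_of, FreeGroup.lift_apply_of,
      ← map_pow, ← map_pow, w_pow, mul_inv_cancel]
  have hx : ∀ i, F (x m n i) = f (w m n i) := fun i => PresentedGroup.toGroup.of _
  have hP : ∀ i, F (Fin.partialProd (fun j : Fin k => (x m n j.castSucc ^ m j)⁻¹) i)
      = (f (PresentedMonoid.mk (rels m n) (wordPrefix m i)))⁻¹ := by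
    intro i
    induction i using Fin.induction with
    | zero => simp [wordPrefix_zero]
    | succ j ih =>
      rw [Fin.partialProd_succ, map_mul, ih, map_inv, map_pow, hx, wordPrefix_succ, map_mul,
        map_pow, map_mul, map_pow, mul_inv_rev]
      rfl
  have hF : ∀ g, F (ofMonoid m n g) = f g := by
    intro g
    obtain ⟨u, rfl⟩ := PresentedMonoid.surjective_mk g
    induction u using FreeMonoid.inductionOn' with
    | one => simp
    | of_mul i u ih =>
      simp only [map_mul, ih]
      congr 1
      change F (coneGen m n i) = f (PresentedMonoid.of (rels m n) i)
      rw [coneGen, map_mul, hP, hx, w_eq, map_mul, inv_mul_cancel_left]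
  exact fun g h e => hf (by rw [← hF, ← hF, e])

lemma image_ofMonoid (hn : ∀ j, 1 ≤ n j) : ofMonoid m n '' {a | a ≠ 1}
    = (Subsemigroup.closure (Set.range (coneGen m n)) : Set (TorusAmalgam m n)) := by
  have hM := isOType m hn
  refine Set.Subset.antisymm ?_ ?_
  · rintro _ ⟨a, ha, rfl⟩
    obtain ⟨u, rfl⟩ := PresentedMonoid.surjective_mk a
    induction u using FreeMonoid.inductionOn' with
    | one => exact absurd (map_one _) ha
    | of_mul i u ih =>
      have hi : coneGen m n i ∈ Subsemigroup.closure (Set.range (coneGen m n)) :=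
        Subsemigroup.subset_closure ⟨i, rfl⟩
      rw [map_mul, map_mul]
      by_cases hu : PresentedMonoid.mk (rels m n) u = 1
      · rw [hu, map_one, mul_one]
        exact hi
      · exact Subsemigroup.mul_mem _ hi (ih hu)
  · let P : Subsemigroup (TorusAmalgam m n) :=
      { carrier := ofMonoid m n '' {a | a ≠ 1}
        mul_mem' := by
          rintro _ _ ⟨a, ha, rfl⟩ ⟨b, -, rfl⟩
          exact ⟨a * b, fun h => ha (hM.eq_one_of_mul_eq_one h), map_mul _ _ _⟩ }
    have hP : Subsemigroup.closure (Set.range (coneGen m n)) ≤ P := by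
      refine Subsemigroup.closure_le.2 ?_
      rintro _ ⟨i, rfl⟩
      refine ⟨PresentedMonoid.of (rels m n) i, fun h => ?_, ofMonoid_of m n i⟩
      exact FreeMonoid.of_ne_one i (((presents_mk m n).map_eq_one_iff _).1 h)
    exact hP

end TorusAmalgam

theorem corollary8p5 (k : ℕ) (hk : 1 ≤ k) (m n : Fin k → ℕ)
    (hm : ∀ j, 1 ≤ m j) (hn : ∀ j, 1 ≤ n j) :
    -- the triangular monoid is of O-type
    IsOType (TriangularMonoid m n) ∧
    -- explicit central powers of the first generator
    (∀ N : ℕ,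
      (∀ i : Fin k, (∏ j ∈ Finset.Iic i, (m j + 1)) ∣ N * ∏ j ∈ Finset.Iio i, (n j + 1)) →
      ∀ g : TriangularMonoid m n,
        PresentedMonoid.of (TriangularMonoid.rels m n) 0 ^ N * g
          = g * PresentedMonoid.of (TriangularMonoid.rels m n) 0 ^ N) ∧
    (∀ g : TriangularMonoid m n,
      PresentedMonoid.of (TriangularMonoid.rels m n) 0 ^ (∏ j, (m j + 1)) * g
        = g * PresentedMonoid.of (TriangularMonoid.rels m n) 0 ^ (∏ j, (m j + 1))) ∧
    -- the group is left-orderable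
    Nonempty (LeftOrdering (TorusAmalgam m n)) ∧
    -- it has an isolated left-ordering with the given positive cone
    ∃ r : LeftOrdering (TorusAmalgam m n),
      r.positiveCone = (Subsemigroup.closure (Set.range (TorusAmalgam.coneGen m n)) :
        Set (TorusAmalgam m n)) ∧
      r.IsIsolated := by
  obtain ⟨r, hr⟩ := (TriangularMonoid.isOType m hn).exists_leftOrdering _
    (TorusAmalgam.ofMonoid_injective m hn) (TorusAmalgam.closure_range_ofMonoid m n)
  rw [TorusAmalgam.image_ofMonoid m hn] at hr
  exact ⟨TriangularMonoid.isOType m hn, TriangularMonoid.pow_central m n,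
    TriangularMonoid.pow_central m n _ (TriangularMonoid.prod_dvd m n), ⟨r⟩,
    r, hr, r.isIsolated_of_positiveCone_eq _ hr⟩
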